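/- Let $r\in\mathbb N$, let $\mathbb C_\pm=\{z\in\mathbb C:\ \pm\operatorname{Im} z>0\}$, and let $C_{a,r\times r}(\mathbb C_\pm)$ be the algebra of $r\times r$ matrix functions whose entries are continuous on the closed half-plane $\{\pm\operatorname{Im} z\ge 0\}$ and bounded and analytic in $\mathbb C_\pm$. Let $G$ be an invertible element of $C_{a,r\times r}(\mathbb C_+)$ or of $C_{a,r\times r}(\mathbb C_-)$ (that is, the pointwise inverse $G^{-1}$ exists and belongs to the same algebra). Then $\det G$ does not vanish on $\mathbb R$ and has a continuous argument $\arg\det G:\mathbb R\to\mathbb R$, and for every $\alpha>0$ and every choice of this argument, the upper and lower mean winding numbers $$\overline w_\alpha(G)=\limsup_{T\to+\infty}\ \sup_{y\in\mathbb R}\ \frac{1+\alpha}{2T^{1+\alpha}}\left[\int_y^{T+y}-\int_{y-T}^{y}\right]\arg\det G(x)\,dx,$$ $$\underline w_\alpha(G)=\liminf_{T\to+\infty}\ \inf_{y\in\mathbb R}\ \frac{1+\alpha}{2T^{1+\alpha}}\left[\int_y^{T+y}-\int_{y-T}^{y}\right]\arg\det G(x)\,dx$$ satisfy $\overline w_\alpha(G)=\underline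 w_\alpha(G)=0$. -/

import Mathlib

open Filter

noncomputable section

/-- The open upper half-plane `ℂ₊` as a subset of `ℂ`. -/
def upperHalf : Set ℂ := {z | 0 < z.im}

/-- The open lower half-plane `ℂ₋` as a subset of `ℂ`. -/
def lowerHalf : Set ℂ := {z | z.im < 0}

/-- The class `C_a` of `r × r` matrix functions on the closure of `U`: every entry is continuous on
the closure of `U`, and analytic and bounded in the open set `U`.
Only the values of `G` on `closure U` matter. -/
def MemCa {r : ℕ} (U : Set ℂ) (G : ℂ → Matrix (Fin r) (Fin r) ℂ) : Prop :=
  ∀ i j, DiffContOnCl ℂ (fun z => G z i j) U ∧ ∃ C : ℝ, ∀ z ∈ U, ‖G z i j‖ ≤ C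

/-- `G` is an invertible element of the algebra `C_a` of `r × r` matrix functions: it is in the
algebra, and so is a two-sided inverse of it. -/
def MemGCa {r : ℕ} (U : Set ℂ) (G : ℂ → Matrix (Fin r) (Fin r) ℂ) : Prop :=
  MemCa U G ∧ ∃ H : ℂ → Matrix (Fin r) (Fin r) ℂ, MemCa U H ∧
    ∀ z ∈ closure U, G z * H z = 1 ∧ H z * G z = 1

/-- The restriction of `det G` to the real line. -/
def detOnReal {r : ℕ} (G : ℂ → Matrix (Fin r) (Fin r) ℂ) : ℝ → ℂ :=
  fun x => (G (x : ℂ)).det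

/-- `θ` is a (continuous) argument of the nonvanishing function `g` on the real line. -/
def IsContArg (g : ℝ → ℂ) (θ : ℝ → ℝ) : Prop :=
  Continuous θ ∧ ∀ x, g x ≠ 0 ∧ g x = (‖g x‖ : ℂ) * Complex.exp ((θ x : ℂ) * Complex.I)

/-- The mean
`(1 + α) / (2 T ^ (1 + α)) * (∫_y^{T+y} θ - ∫_{y-T}^y θ)`. -/
def windingMean (α : ℝ) (θ : ℝ → ℝ) (T y : ℝ) : ℝ :=
  (1 + α) / (2 * T ^ (1 + α)) * ((∫ x in y..(T + y), θ x) - ∫ x in (y - T)..y, θ x)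

/-- The upper mean winding number of exponent `α` of a function with argument `θ`, as an extended
real number: the upper limit, as `T → +∞`, of the supremum over `y` of the means. -/
def upperMeanWinding (α : ℝ) (θ : ℝ → ℝ) : EReal :=
  limsup (fun T : ℝ => ⨆ y : ℝ, (windingMean α θ T y : EReal)) atTop

/-- The lower mean winding number of exponent `α` of a function with argument `θ`, as an extended
real number: the lower limit, as `T → +∞`, of the infimum over `y` of the means. -/
def lowerMeanWinding (α : ℝ) (θ : ℝ → ℝ) : EReal :=
  liminf (fun T : ℝ => ⨅ y : ℝ, (windingMean α θ T y : EReal)) atTop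

end

/-! Both `det G` and its inverse are bounded and analytic in the half-plane, so `det G = exp L`
there with `L.re` bounded; by Cauchy's estimate, `L' = (det G)' / det G` is `O(1 / im z)`. The
boundary argument `L.im` may be unbounded, but the difference of its integrals over adjacent
intervals of length `T` is `O(T)` uniformly in `y`. Indeed, Cauchy's theorem on a square of side `T`
moves each integral to height `T` at cost `O(T)`, only `L.re` entering on the vertical sides
(`abs_integral_im_sub_integral_im_le`); at height `T` a shift by `T` changes `L` by `O(1)`
(`norm_sub_le_of_norm_deriv_le_div_im`). Division by `T ^ (1 + α)` leaves `O(T ^ (-α))`. -/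

/-- The unnormalised winding mean `∫_y^{T+y} θ - ∫_{y-T}^y θ`. -/
noncomputable def windingDiff (θ : ℝ → ℝ) (T y : ℝ) : ℝ :=
  (∫ x in y..(T + y), θ x) - ∫ x in (y - T)..y, θ x

theorem windingMean_eq (α : ℝ) (θ : ℝ → ℝ) (T y : ℝ) :
    windingMean α θ T y = (1 + α) / (2 * T ^ (1 + α)) * windingDiff θ T y := rfl

/-- If the unnormalised means grow at most linearly in `T`, uniformly in `y`, then both mean
winding numbers of every positive exponent vanish. -/
theorem meanWinding_eq_zero_of_windingDiff_le {α : ℝ} (hα : 0 < α) {θ : ℝ → ℝ} {C : ℝ}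
    (hC : ∀ T > 0, ∀ y, |windingDiff θ T y| ≤ C * T) :
    upperMeanWinding α θ = 0 ∧ lowerMeanWinding α θ = 0 := by
  have hb : ∀ T > 0, ∀ y, |windingMean α θ T y| ≤ (1 + α) / 2 * C * T ^ (-α) := by
    intro T hT y
    have hTp : 0 < T ^ (1 + α) := Real.rpow_pos_of_pos hT _
    have hT' : T ^ (1 + α) = T * T ^ α := by rw [Real.rpow_add hT, Real.rpow_one]
    have hTa : 0 < T ^ α := Real.rpow_pos_of_pos hT _
    rw [windingMean_eq, abs_mul, abs_of_nonneg (by positivity)]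
    calc (1 + α) / (2 * T ^ (1 + α)) * |windingDiff θ T y|
        ≤ (1 + α) / (2 * T ^ (1 + α)) * (C * T) :=
          mul_le_mul_of_nonneg_left (hC T hT y) (by positivity)
      _ = (1 + α) / 2 * C * T ^ (-α) := by
          rw [hT', Real.rpow_neg hT.le]
          field_simp
  have hlim : Tendsto (fun T : ℝ => (1 + α) / 2 * C * T ^ (-α)) atTop (nhds 0) := by
    simpa using (tendsto_rpow_neg_atTop hα).const_mul ((1 + α) / 2 * C)
  have hpos : Tendsto (fun T : ℝ => (((1 + α) / 2 * C * T ^ (-α) : ℝ) : EReal)) atTop (nhds 0) := by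
    rw [← EReal.coe_zero]
    exact EReal.tendsto_coe.2 hlim
  have hneg : Tendsto (fun T : ℝ => ((-((1 + α) / 2 * C * T ^ (-α)) : ℝ) : EReal)) atTop
      (nhds 0) := by
    have := hlim.neg
    rw [neg_zero] at this
    rw [← EReal.coe_zero]
    exact EReal.tendsto_coe.2 this
  have hev : ∀ᶠ T : ℝ in atTop, 0 < T := eventually_gt_atTop 0
  constructor
  · refine Tendsto.limsup_eq (tendsto_of_tendsto_of_tendsto_of_le_of_le' hneg hpos ?_ ?_)
    · filter_upwards [hev] with T hT
      exact le_iSup_of_le 0 (EReal.coe_le_coe_iff.2 (abs_le.1 (hb T hT 0)).1)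
    · filter_upwards [hev] with T hT
      exact iSup_le fun y => EReal.coe_le_coe_iff.2 (abs_le.1 (hb T hT y)).2
  · refine Tendsto.liminf_eq (tendsto_of_tendsto_of_tendsto_of_le_of_le' hneg hpos ?_ ?_)
    · filter_upwards [hev] with T hT
      exact le_iInf fun y => EReal.coe_le_coe_iff.2 (abs_le.1 (hb T hT y)).1
    · filter_upwards [hev] with T hT
      exact iInf_le_of_le 0 (EReal.coe_le_coe_iff.2 (abs_le.1 (hb T hT 0)).2)

theorem windingDiff_add_const {θ : ℝ → ℝ} (hθ : Continuous θ) (c T y : ℝ) :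
    windingDiff (fun x => θ x + c) T y = windingDiff θ T y := by
  unfold windingDiff
  rw [intervalIntegral.integral_add (hθ.intervalIntegrable _ _) (by simp),
    intervalIntegral.integral_add (hθ.intervalIntegrable _ _) (by simp)]
  simp only [intervalIntegral.integral_const, smul_eq_mul]
  ring

theorem windingDiff_comp_neg (θ : ℝ → ℝ) (T y : ℝ) :
    windingDiff (fun x => θ (-x)) T y = -windingDiff θ T (-y) := by
  unfold windingDiff
  rw [intervalIntegral.integral_comp_neg, intervalIntegral.integral_comp_neg]
  rw [show -(T + y) = -y - T by ring, show -(y - T) = T + -y by ring]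
  ring

/-- Two continuous arguments of the same function differ by a constant. -/
theorem IsContArg.exists_eq_add_const {g : ℝ → ℂ} {θ φ : ℝ → ℝ} (hθ : IsContArg g θ)
    (hφ : IsContArg g φ) : ∃ c : ℝ, θ = fun x => φ x + c := by
  have h1 : ∀ x, Circle.exp (θ x - φ x) = 1 := by
    intro x
    have hg : (‖g x‖ : ℂ) ≠ 0 := by simpa using (hθ.2 x).1
    have h : Complex.exp ((θ x : ℂ) * Complex.I) = Complex.exp ((φ x : ℂ) * Complex.I) :=
      mul_left_cancel₀ hg ((hθ.2 x).2.symm.trans (hφ.2 x).2)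
    apply Circle.ext
    rw [Circle.coe_exp, Complex.ofReal_sub, sub_mul, Complex.exp_sub, h,
      div_self (Complex.exp_ne_zero _), Circle.coe_one]
  refine ⟨θ 0 - φ 0, funext fun x => ?_⟩
  -- The difference lifts a constant map through the covering `Circle.exp`, and `ℝ` is connected.
  have := Circle.isCoveringMap_exp.const_of_comp (hθ.1.sub hφ.1)
    (fun a a' => by rw [Pi.sub_apply, Pi.sub_apply, h1, h1]) x 0
  simp only [Pi.sub_apply] at this
  linarith

theorem IsContArg.comp_neg {g : ℝ → ℂ} {θ : ℝ → ℝ} (hθ : IsContArg g θ) :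
    IsContArg (fun x => g (-x)) (fun x => θ (-x)) :=
  ⟨hθ.1.comp continuous_neg, fun x => hθ.2 (-x)⟩

theorem isOpen_upperHalf : IsOpen upperHalf := isOpen_lt continuous_const Complex.continuous_im

theorem mem_closure_upperHalf {z : ℂ} : z ∈ closure upperHalf ↔ 0 ≤ z.im := by
  unfold upperHalf
  rw [Complex.closure_setOfPred_lt_im]; rfl

theorem mem_closure_lowerHalf {z : ℂ} : z ∈ closure lowerHalf ↔ z.im ≤ 0 := by
  unfold lowerHalf
  rw [Complex.closure_setOfPred_im_lt]; rfl

/-- A zero-free function on the closed upper half-plane has there a continuous logarithm, which is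
analytic in the open half-plane. -/
theorem exists_continuous_log_upperHalf {f : ℂ → ℂ} (hf : DiffContOnCl ℂ f upperHalf)
    (hne : ∀ z ∈ closure upperHalf, f z ≠ 0) :
    ∃ L : ℂ → ℂ, Continuous L ∧ (∀ z : ℂ, 0 ≤ z.im → Complex.exp (L z) = f z) ∧
      ∀ z ∈ upperHalf, HasDerivAt L ((f z)⁻¹ * deriv f z) z := by
  -- Folding the plane onto the closed half-plane makes `f ∘ ρ` continuous and zero-free on all of
  -- `ℂ`, which is open and simply connected, so the logarithm extends up to the boundary.
  let ρ : ℂ → ℂ := fun z => z.re + |z.im| * Complex.I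
  have hρc : Continuous ρ := by fun_prop
  have hρim : ∀ z, (ρ z).im = |z.im| := fun z => by simp [ρ]
  have hρ : ∀ z : ℂ, 0 ≤ z.im → ρ z = z := fun z hz => by
    simp [ρ, abs_of_nonneg hz, Complex.re_add_im]
  have hρmem : ∀ z, ρ z ∈ closure upperHalf := fun z =>
    mem_closure_upperHalf.2 (by rw [hρim]; exact abs_nonneg _)
  have hsc : IsSimplyConnected (Set.univ : Set ℂ) := by
    change SimplyConnectedSpace (Set.univ : Set ℂ)
    have := (convex_univ (𝕜 := ℝ) (E := ℂ)).contractibleSpace Set.univ_nonempty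
    infer_instance
  obtain ⟨L, hLc, hL⟩ := Complex.exists_continuousOn_eqOn_exp_comp hsc isOpen_univ
    (g := f ∘ ρ) (hf.continuousOn.comp_continuous hρc hρmem).continuousOn
    (by rintro ⟨z, -, hz⟩; exact hne _ (hρmem z) hz)
  have hLc' : Continuous L := continuousOn_univ.1 hLc
  have hexp : ∀ z : ℂ, 0 ≤ z.im → Complex.exp (L z) = f z := fun z hz => by
    have := hL (Set.mem_univ z)
    simpa [hρ z hz] using this
  refine ⟨L, hLc', hexp, fun z hz => ?_⟩
  have hfz : f z ≠ 0 := hne z (subset_closure hz)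
  have h1 : HasDerivAt Complex.exp (f z) (L z) := by
    simpa [hexp z (le_of_lt hz)] using Complex.hasDerivAt_exp (L z)
  have h2 : HasDerivAt f (deriv f z) z :=
    (hf.differentiableAt isOpen_upperHalf hz).hasDerivAt
  have h3 : Complex.exp ∘ L =ᶠ[nhds z] f := by
    filter_upwards [isOpen_upperHalf.mem_nhds hz] with w hw
    exact hexp w (le_of_lt hw)
  -- `L` is continuous and `exp` has invertible derivative, so differentiability of `exp ∘ L = f`
  -- passes to `L`.
  have h4 := HasFDerivAt.of_comp_of_leftInverse
    (f'symm := ContinuousLinearMap.toSpanSingleton ℂ (f z)⁻¹)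
    hLc'.continuousAt h1.hasFDerivAt h2.hasFDerivAt h3 (fun w => by simp [hfz])
  have h5 := h4.hasDerivAt
  simpa [mul_comm] using h5

open Complex in
/-- Cauchy's theorem on a square standing on the real line, for the imaginary part of a function
whose real part is bounded. -/
theorem abs_integral_im_sub_integral_im_le {L : ℂ → ℂ} (hc : Continuous L)
    (hd : DifferentiableOn ℂ L upperHalf) {M : ℝ} (hM : ∀ z ∈ upperHalf, |(L z).re| ≤ M)
    {T : ℝ} (hT : 0 < T) (a : ℝ) :
    |(∫ x in a..(a + T), (L x).im) - ∫ x in a..(a + T), (L (x + T * I)).im| ≤ 2 * M * T := by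
  have hcauchy := integral_boundary_rect_eq_zero_of_continuousOn_of_differentiableOn L
    (a : ℂ) ((a + T : ℝ) + T * I) hc.continuousOn (hd.mono (by
      intro z hz
      have := hz.2.1
      simpa [hT.le, upperHalf] using this))
  have hint : ∀ (γ : ℝ → ℂ) (_ : Continuous γ) (p q : ℝ),
      (∫ x in p..q, L (γ x)).im = ∫ x in p..q, (L (γ x)).im := fun γ hγ p q => by
    have := (Complex.imCLM).intervalIntegral_comp_comm
      ((hc.comp hγ).intervalIntegrable (μ := MeasureTheory.volume) p q)
    simpa using this.symm
  have hintre : ∀ (γ : ℝ → ℂ) (_ : Continuous γ) (p q : ℝ),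
      (∫ x in p..q, L (γ x)).re = ∫ x in p..q, (L (γ x)).re := fun γ hγ p q => by
    have := (Complex.reCLM).intervalIntegral_comp_comm
      ((hc.comp hγ).intervalIntegrable (μ := MeasureTheory.volume) p q)
    simpa using this.symm
  have hvert : ∀ b : ℝ, |∫ t in (0 : ℝ)..T, (L (b + t * I)).re| ≤ M * T := fun b => by
    have := intervalIntegral.norm_integral_le_of_norm_le_const (a := 0) (b := T) (C := M)
      (f := fun t : ℝ => (L (b + t * I)).re) (fun t ht => by
        rw [Set.uIoc_of_le hT.le] at ht
        exact hM _ (by simpa [upperHalf] using ht.1))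
    simpa [abs_of_pos hT] using this
  -- The factor `I` on the vertical sides turns their imaginary part into integrals of `L.re`, each
  -- at most `M * T`.
  have him := congrArg Complex.im hcauchy
  simp only [Complex.add_im, Complex.sub_im, smul_eq_mul, Complex.mul_im, Complex.I_re,
    Complex.I_im, zero_mul, one_mul, zero_add, Complex.ofReal_re, Complex.ofReal_im,
    Complex.add_re, Complex.mul_re, mul_zero, mul_one, sub_self, add_zero, Complex.ofReal_zero,
    Complex.zero_im] at him
  rw [hint _ (by fun_prop), hint _ (by fun_prop), hintre _ (by fun_prop),
    hintre _ (by fun_prop)] at him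
  have h1 := abs_le.1 (hvert a)
  have h2 := abs_le.1 (hvert (a + T))
  push_cast at him h1 h2 ⊢
  rw [abs_le]
  constructor <;> linarith [h1.1, h1.2, h2.1, h2.2]

open Complex in
/-- Moving horizontally by the height changes a function with derivative `O(1 / im z)` by `O(1)`. -/
theorem norm_sub_le_of_norm_deriv_le_div_im {L : ℂ → ℂ} (hd : DifferentiableOn ℂ L upperHalf)
    {K : ℝ} (hK : 0 ≤ K) (hderiv : ∀ z ∈ upperHalf, ‖deriv L z‖ ≤ K / z.im) {T : ℝ} (hT : 0 < T)
    (x : ℝ) : ‖L ((x + T : ℝ) + T * I) - L (x + T * I)‖ ≤ K := by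
  have hs : Convex ℝ {z : ℂ | T ≤ z.im} := convex_halfSpace_ge Complex.imLm.isLinear T
  have hsub : ∀ z ∈ {z : ℂ | T ≤ z.im}, z ∈ upperHalf := fun z hz => lt_of_lt_of_le hT hz
  have := hs.norm_image_sub_le_of_norm_deriv_le (f := L) (C := K / T)
    (x := x + T * I) (y := (x + T : ℝ) + T * I)
    (fun z hz => hd.differentiableAt (isOpen_upperHalf.mem_nhds (hsub z hz)))
    (fun z hz => (hderiv z (hsub z hz)).trans (div_le_div_of_nonneg_left hK hT hz))
    (by simp) (by simp)
  have hn : ‖((x + T : ℝ) + T * I : ℂ) - (x + T * I)‖ = T := by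
    rw [show ((x + T : ℝ) + T * I : ℂ) - (x + T * I) = (T : ℂ) by push_cast; ring]
    simp [abs_of_pos hT]
  rw [hn, div_mul_cancel₀ _ hT.ne'] at this
  exact this

-- Raising the two integrals to height `T` costs `2 * M * T` each; there they are translates by `T`
-- of one another, which costs `K * T`.
open Complex in
theorem abs_windingDiff_im_le {L : ℂ → ℂ} (hc : Continuous L)
    (hd : DifferentiableOn ℂ L upperHalf) {M K : ℝ} (hM : ∀ z ∈ upperHalf, |(L z).re| ≤ M)
    (hK : 0 ≤ K) (hderiv : ∀ z ∈ upperHalf, ‖deriv L z‖ ≤ K / z.im) {T : ℝ} (hT : 0 < T)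
    (y : ℝ) : |windingDiff (fun x => (L x).im) T y| ≤ (4 * M + K) * T := by
  have h1 := abs_integral_im_sub_integral_im_le hc hd hM hT y
  have h2 := abs_integral_im_sub_integral_im_le hc hd hM hT (y - T)
  have hcont : Continuous fun x : ℝ => (L (x + T * I)).im := by fun_prop
  have h3 : |(∫ x in y..(y + T), (L (x + T * I)).im) - ∫ x in (y - T)..y, (L (x + T * I)).im|
      ≤ K * T := by
    have hshift : ∫ x in y..(y + T), (L (x + T * I)).im
        = ∫ x in (y - T)..y, (L ((x + T : ℝ) + T * I)).im := by
      rw [intervalIntegral.integral_comp_add_right (fun x : ℝ => (L (x + T * I)).im) T,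
        sub_add_cancel]
    rw [hshift, ← intervalIntegral.integral_sub
      ((by fun_prop : Continuous fun x : ℝ => (L ((x + T : ℝ) + T * I)).im).intervalIntegrable _ _)
      (hcont.intervalIntegrable _ _)]
    have := intervalIntegral.norm_integral_le_of_norm_le_const (a := y - T) (b := y) (C := K)
      (f := fun x : ℝ => (L ((x + T : ℝ) + T * I)).im - (L (x + T * I)).im) (fun x _ => by
        rw [← Complex.sub_im]
        exact (Complex.abs_im_le_norm _).trans
          (norm_sub_le_of_norm_deriv_le_div_im hd hK hderiv hT x))
    simpa [abs_of_pos hT] using this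
  unfold windingDiff
  rw [sub_add_cancel] at h2
  rw [add_comm T y]
  rw [abs_le] at *
  constructor <;> linarith [h1.1, h1.2, h2.1, h2.2, h3.1, h3.2]

/-- The Cauchy estimate for a bounded analytic function in the upper half-plane. -/
theorem norm_deriv_le_of_bounded_upperHalf {f : ℂ → ℂ} (hf : DifferentiableOn ℂ f upperHalf)
    {A : ℝ} (hA : ∀ z ∈ upperHalf, ‖f z‖ ≤ A) {z : ℂ} (hz : z ∈ upperHalf) :
    ‖deriv f z‖ ≤ 2 * A / z.im := by
  have hz' : 0 < z.im := hz
  -- Half the distance to the real line keeps the closed disc inside; this is the source of the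
  -- factor 2.
  have hball : Metric.closedBall z (z.im / 2) ⊆ upperHalf := by
    intro w hw
    have h1 : |(w - z).im| ≤ z.im / 2 :=
      (Complex.abs_im_le_norm _).trans (by simpa [dist_eq_norm] using hw)
    have := (abs_le.1 h1).1
    rw [Complex.sub_im] at this
    change 0 < w.im
    linarith
  have := Complex.norm_deriv_le_of_forall_mem_sphere_norm_le (half_pos hz')
    (hf.diffContOnCl_ball hball)
    (fun w hw => hA w (hball (Metric.sphere_subset_closedBall hw)))
  rwa [div_div_eq_mul_div, mul_comm A] at this

/-- A function which is bounded and bounded away from zero in the upper half-plane has on the real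
line a continuous argument with linearly bounded unnormalised winding means. -/
theorem exists_isContArg_windingDiff_le {f g : ℂ → ℂ} (hf : DiffContOnCl ℂ f upperHalf)
    {A B : ℝ} (hA : ∀ z ∈ upperHalf, ‖f z‖ ≤ A) (hB : ∀ z ∈ upperHalf, ‖g z‖ ≤ B)
    (hfg : ∀ z ∈ closure upperHalf, f z * g z = 1) :
    ∃ θ : ℝ → ℝ, IsContArg (fun x : ℝ => f x) θ ∧
      ∃ C : ℝ, ∀ T > 0, ∀ y, |windingDiff θ T y| ≤ C * T := by
  have hne : ∀ z ∈ closure upperHalf, f z ≠ 0 := fun z hz =>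
    left_ne_zero_of_mul_eq_one (hfg z hz)
  obtain ⟨L, hLc, hexp, hLd⟩ := exists_continuous_log_upperHalf hf hne
  have hre : ∀ z : ℂ, 0 ≤ z.im → Real.exp (L z).re = ‖f z‖ := fun z hz => by
    rw [← hexp z hz, Complex.norm_exp]
  have hinv : ∀ z ∈ upperHalf, ‖f z‖⁻¹ = ‖g z‖ := fun z hz => by
    rw [← norm_inv, eq_comm, eq_inv_of_mul_eq_one_right (hfg z (subset_closure hz))]
  have hI : Complex.I ∈ upperHalf := by simp [upperHalf]
  have hA0 : 0 ≤ A := (norm_nonneg _).trans (hA _ hI)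
  have hB0 : 0 ≤ B := (norm_nonneg _).trans (hB _ hI)
  -- `L.re = log ‖f‖`, bounded above through `f` and below through `g = 1 / f`.
  have hM : ∀ z ∈ upperHalf, |(L z).re| ≤ max (Real.log A) (Real.log B) := by
    intro z hz
    have hfz : 0 < ‖f z‖ := norm_pos_iff.2 (hne z (subset_closure hz))
    have hlog : (L z).re = Real.log ‖f z‖ := by rw [← hre z (le_of_lt hz), Real.log_exp]
    rw [hlog, abs_le']
    refine ⟨(Real.log_le_log hfz (hA z hz)).trans (le_max_left _ _), ?_⟩
    rw [← Real.log_inv]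
    refine (Real.log_le_log (inv_pos.2 hfz) ?_).trans (le_max_right _ _)
    rw [hinv z hz]
    exact hB z hz
  have hderiv : ∀ z ∈ upperHalf, ‖deriv L z‖ ≤ (B * (2 * A)) / z.im := by
    intro z hz
    rw [(hLd z hz).deriv, norm_mul, norm_inv, hinv z hz, mul_div_assoc]
    exact mul_le_mul (hB z hz) (norm_deriv_le_of_bounded_upperHalf hf.differentiableOn hA hz)
      (norm_nonneg _) hB0
  refine ⟨fun x => (L x).im, ⟨by fun_prop, fun x => ⟨hne x (mem_closure_upperHalf.2 (by simp)), ?_⟩⟩,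
    _, fun T hT y => abs_windingDiff_im_le hLc
      (fun z hz => (hLd z hz).differentiableAt.differentiableWithinAt) hM (by positivity) hderiv hT y⟩
  have hx : (0 : ℝ) ≤ (x : ℂ).im := by simp
  rw [← hre x hx, Complex.ofReal_exp, ← Complex.exp_add, Complex.re_add_im, hexp x hx]

theorem MemCa.det {r : ℕ} {U : Set ℂ} {G : ℂ → Matrix (Fin r) (Fin r) ℂ} (hG : MemCa U G) :
    DiffContOnCl ℂ (fun z => (G z).det) U ∧ ∃ C : ℝ, ∀ z ∈ U, ‖(G z).det‖ ≤ C := by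
  choose hd C hC using hG
  simp only [Matrix.det_apply']
  refine ⟨⟨?_, ?_⟩, ∑ σ : Equiv.Perm (Fin r), ∏ i, C (σ i) i, fun z hz => ?_⟩
  · exact DifferentiableOn.fun_sum fun σ _ => (DifferentiableOn.fun_finsetProd fun i _ =>
      (hd (σ i) i).differentiableOn).const_mul _
  · exact continuousOn_finsetSum _ fun σ _ => continuousOn_const.mul
      (continuousOn_finsetProd _ fun i _ => (hd (σ i) i).continuousOn)
  · refine norm_sum_le_of_le _ fun σ _ => ?_
    rw [norm_mul, norm_prod]
    have hsign : ‖((Equiv.Perm.sign σ : ℤ) : ℂ)‖ = 1 := by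
      rcases Int.units_eq_one_or (Equiv.Perm.sign σ) with h | h <;> simp [h]
    rw [hsign, one_mul]
    exact Finset.prod_le_prod (fun _ _ => norm_nonneg _) fun i _ => hC (σ i) i z hz

/-- The lower half-plane reduces to the upper one by `z ↦ -z`, which only flips the sign of the mean
and replaces `y` by `-y`; the bound is uniform in `y`. -/
theorem MemGCa.exists_isContArg_windingDiff_le {r : ℕ} {G : ℂ → Matrix (Fin r) (Fin r) ℂ}
    (hG : MemGCa upperHalf G ∨ MemGCa lowerHalf G) :
    ∃ θ : ℝ → ℝ, IsContArg (detOnReal G) θ ∧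
      ∃ C : ℝ, ∀ T > 0, ∀ y, |windingDiff θ T y| ≤ C * T := by
  rcases hG with ⟨hG, H, hH, hGH⟩ | ⟨hG, H, hH, hGH⟩
  · obtain ⟨hd, A, hA⟩ := hG.det
    obtain ⟨-, B, hB⟩ := hH.det
    exact _root_.exists_isContArg_windingDiff_le hd hA hB
      fun z hz => by rw [← Matrix.det_mul, (hGH z hz).1, Matrix.det_one]
  · obtain ⟨hd, A, hA⟩ := hG.det
    obtain ⟨-, B, hB⟩ := hH.det
    have hmaps : Set.MapsTo (fun z : ℂ => -z) upperHalf lowerHalf := fun z hz => by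
      simpa [upperHalf, lowerHalf] using hz
    obtain ⟨θ, hθ, C, hC⟩ := _root_.exists_isContArg_windingDiff_le
      (hd.comp differentiable_neg.diffContOnCl hmaps)
      (fun z hz => hA _ (hmaps hz)) (fun z hz => hB _ (hmaps hz))
      fun z hz => by
        have hz' : -z ∈ closure lowerHalf :=
          mem_closure_lowerHalf.2 (by simpa using mem_closure_upperHalf.1 hz)
        simp only [Function.comp_apply]
        rw [← Matrix.det_mul, (hGH _ hz').1, Matrix.det_one]
    refine ⟨fun x => θ (-x), ?_, C, fun T hT y => ?_⟩
    · have h := hθ.comp_neg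
      simp only [Function.comp_apply, Complex.ofReal_neg, neg_neg] at h
      exact h
    · rw [windingDiff_comp_neg, abs_neg]
      exact hC T hT (-y)

theorem corollary2 (r : ℕ) (G : ℂ → Matrix (Fin r) (Fin r) ℂ)
    (hG : MemGCa upperHalf G ∨ MemGCa lowerHalf G) (α : ℝ) (hα : 0 < α) :
    (∃ θ : ℝ → ℝ, IsContArg (detOnReal G) θ) ∧
      ∀ θ : ℝ → ℝ, IsContArg (detOnReal G) θ →
        upperMeanWinding α θ = 0 ∧ lowerMeanWinding α θ = 0 := by
  obtain ⟨φ, hφ, C, hC⟩ := MemGCa.exists_isContArg_windingDiff_le hG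
  refine ⟨⟨φ, hφ⟩, fun θ hθ => meanWinding_eq_zero_of_windingDiff_le hα (C := C) fun T hT y => ?_⟩
  obtain ⟨c, rfl⟩ := hθ.exists_eq_add_const hφ
  rw [windingDiff_add_const hφ.1]
  exact hC T hT y
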